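/- Let $n\ge 1$ be an integer, let $\mathbb{R}_+^n=\{x\in\mathbb{R}^n : x_i>0 \text{ for } i=1,\dots,n\}$, and let $k_1,\dots,k_n>1$ be real numbers, not necessarily integers. Let $\varphi:\mathbb{R}_+^n\to\mathbb{R}$ be a $C^\infty$-smooth function such that $$(x_1,\dots,x_n)\mapsto \varphi\left(x_1^{k_1},\dots,x_n^{k_n}\right)$$ is convex on $\mathbb{R}_+^n$, and let $\mu$ be the Borel measure on $\mathbb{R}_+^n$ with density $\exp(-\varphi)$ with respect to Lebesgue measure (possibly of infinite total mass). Let $f:\mathbb{R}_+^n\to\mathbb{R}$ be a $\mu$-integrable, locally Lipschitz function with $\int f\,d\mu=0$. Then $$\int_{\mathbb{R}_+^n} f^2\,d\mu\;\le\;\int_{\mathbb{R}_+^n}\sum_{i=1}^n \frac{k_i^2}{k_i-1}\,x_i^2\,\left|\partial^i f(x)\right|^2\,d\mu(x),$$ where $\partial^i f=\partial f/\partial x_i$ is the partial derivative with respect to the $i$-th variable (defined almost everywhere), and both sides are understood as elements of $[0,\infty]$. -/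

import Mathlib

open MeasureTheory
open scoped ContDiff ENNReal

/-- The open orthant of all points of `ℝⁿ` with positive coordinates. -/
def posOrthant (n : ℕ) : Set (Fin n → ℝ) := {x | ∀ i, 0 < x i}

/-- The partial derivative of `f` with respect to the `i`-th variable at `x`, that is, the
derivative at `t = 0` of `t ↦ f (x + t eᵢ)`. -/
noncomputable def partialD {n : ℕ} (i : Fin n) (f : (Fin n → ℝ) → ℝ) (x : Fin n → ℝ) : ℝ :=
  lineDeriv ℝ f x (Pi.single i 1)

/-- The Borel measure on the open orthant with density `exp (-φ)` with respect to Lebesgue measure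
(extended by zero to `ℝⁿ`; only the values of `φ` on the orthant matter). -/
noncomputable def orthantMeasure {n : ℕ} (φ : (Fin n → ℝ) → ℝ) : Measure (Fin n → ℝ) :=
  (volume.restrict (posOrthant n)).withDensity (fun x => ENNReal.ofReal (Real.exp (-φ x)))

/-!
The inequality is the Brascamp-Lieb inequality in the coordinates `x i = y i ^ k i`. In these
coordinates the potential is `W y = φ (y ^ k) - ∑ i, log (k i * y i ^ (k i - 1))`; its first term is
convex, so the Hessian of `W` dominates the diagonal matrix with entries `(k i - 1) / y i ^ 2`, and
by the chain rule `(∂ᵢ g) ^ 2 * y i ^ 2 / (k i - 1)` for `g y = f (y ^ k)` is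
`k i ^ 2 / (k i - 1) * x i ^ 2 * (∂ᵢ f) ^ 2`.

The Brascamp-Lieb inequality follows from the Prékopa-Leindler inequality by the method of Bobkov
and Ledoux: for `ν` with density `exp (-W)`, Prékopa-Leindler bounds
`(∫ exp (t * g) ∂ν) * (∫ exp (-t * g) ∂ν)` by the square of `∫ exp (t ^ 2 * r t) ∂ν`, where `r t`
is a rescaled sup-convolution of `g` with `limsup r t ≤ ∑ i, (∂ᵢ g) ^ 2 / (2 * w i)` as `t → 0`,
and the coefficients of `t ^ 2` give the variance bound. This applies to Lipschitz functions on
bounded convex sets; the general case follows by exhaustion.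
-/

open Set Filter Topology
open scoped NNReal Pointwise

section PrekopaLeindler

variable {a b : ℝ}

lemma rpow_mul_rpow_le_add (ha : 0 < a) (hb : 0 < b) (hab : a + b = 1) (x y : ℝ≥0∞) :
    x ^ a * y ^ b ≤ ENNReal.ofReal a * x + ENNReal.ofReal b * y := by
  have hpq : (1 / a).HolderConjugate (1 / b) := Real.holderConjugate_one_div ha hb hab
  have young := ENNReal.young_inequality (x ^ a) (y ^ b) hpq
  rwa [← ENNReal.rpow_mul, ← ENNReal.rpow_mul, mul_one_div_cancel ha.ne', mul_one_div_cancel hb.ne',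
    ENNReal.rpow_one, ENNReal.rpow_one, one_div, one_div, ENNReal.ofReal_inv_of_pos ha,
    ENNReal.ofReal_inv_of_pos hb, div_eq_mul_inv, div_eq_mul_inv, inv_inv, inv_inv,
    mul_comm x, mul_comm y] at young

lemma volume_setOf_ofReal_lt (c : ℝ≥0∞) :
    (volume.restrict (Ioi (0 : ℝ))) {t | ENNReal.ofReal t < c} = c := by
  rw [Measure.restrict_apply (measurableSet_lt (by fun_prop) measurable_const)]
  induction c with
  | top =>
    simp
  | coe c =>
    have : {t : ℝ | ENNReal.ofReal t < c} ∩ Ioi 0 = Ioo 0 (c : ℝ) := by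
      ext t
      rw [mem_inter_iff, mem_Ioi, mem_Ioo, and_comm, and_congr_right_iff]
      intro ht
      simp [ENNReal.ofReal_lt_iff_lt_toReal ht.le ENNReal.coe_ne_top]
    rw [this, Real.volume_Ioo, sub_zero, ENNReal.ofReal_coe_nnreal]

lemma lintegral_eq_lintegral_measure_setOf_ofReal_lt {α : Type*} [MeasurableSpace α]
    {μ : Measure α} [SFinite μ] {f : α → ℝ≥0∞} (hf : Measurable f) :
    ∫⁻ x, f x ∂μ = ∫⁻ t in Ioi (0 : ℝ), μ {x | ENNReal.ofReal t < f x} := by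
  have hS : MeasurableSet {p : α × ℝ | ENNReal.ofReal p.2 < f p.1} :=
    measurableSet_lt (by fun_prop) (by fun_prop)
  calc ∫⁻ x, f x ∂μ
      = ∫⁻ x, volume.restrict (Ioi (0 : ℝ)) {t | ENNReal.ofReal t < f x} ∂μ := by
        simp only [volume_setOf_ofReal_lt]
    _ = (μ.prod (volume.restrict (Ioi 0))) {p | ENNReal.ofReal p.2 < f p.1} :=
        (Measure.prod_apply hS).symm
    _ = _ := Measure.prod_apply_symm hS

lemma tendsto_lintegral_min_natCast {α : Type*} [MeasurableSpace α] {μ : Measure α}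
    {w : α → ℝ≥0∞} (hw : Measurable w) :
    Tendsto (fun N : ℕ => ∫⁻ x, min (w x) N ∂μ) atTop (𝓝 (∫⁻ x, w x ∂μ)) := by
  refine lintegral_tendsto_of_tendsto_of_monotone (fun N => (hw.min measurable_const).aemeasurable)
    (.of_forall fun x N M hNM => ?_) (.of_forall fun x => ?_)
  · exact min_le_min_left _ (Nat.cast_le.2 hNM)
  · simpa using (tendsto_const_nhds (x := w x)).min ENNReal.tendsto_nat_nhds_top

lemma volume_add_volume_le_of_isCompact {K L : Set ℝ} (hK : IsCompact K) (hL : IsCompact L)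
    (hK₀ : K.Nonempty) (hL₀ : L.Nonempty) : volume K + volume L ≤ volume (K + L) := by
  have hmax := hK.sSup_mem hK₀
  have hmin := hL.sInf_mem hL₀
  have hdisj : AEDisjoint volume ((· + sInf L) '' K) ((sSup K + ·) '' L) := by
    refine measure_mono_null (t := {sSup K + sInf L}) ?_ (measure_singleton _)
    rintro _ ⟨⟨x, hx, rfl⟩, ⟨y, hy, hxy⟩⟩
    have hxK : x ≤ sSup K := le_csSup hK.bddAbove hx
    have hyL : sInf L ≤ y := csInf_le hL.bddBelow hy
    rw [mem_singleton_iff]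
    linarith
  calc volume K + volume L
      = volume ((· + sInf L) '' K) + volume ((sSup K + ·) '' L) := by
        simp only [image_add_right, image_add_left, measure_preimage_add_right,
          measure_preimage_add]
    _ = volume ((· + sInf L) '' K ∪ (sSup K + ·) '' L) :=
        (measure_union₀ (hL.image (by fun_prop)).nullMeasurableSet hdisj).symm
    _ ≤ volume (K + L) := by
        refine measure_mono (union_subset ?_ ?_)
        · exact image_subset_iff.2 fun x hx => add_mem_add hx hmin
        · exact image_subset_iff.2 fun y hy => add_mem_add hmax hy

lemma volume_add_volume_le_volume_add {A B : Set ℝ} (hA : MeasurableSet A) (hB : MeasurableSet B)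
    (hA₀ : A.Nonempty) (hB₀ : B.Nonempty) : volume A + volume B ≤ volume (A + B) := by
  obtain ⟨x, hx⟩ := hA₀
  obtain ⟨y, hy⟩ := hB₀
  rw [hA.measure_eq_iSup_isCompact, hB.measure_eq_iSup_isCompact]
  simp only [iSup_and']
  refine ENNReal.biSup_add_biSup_le' ⟨∅, by simp⟩ ⟨∅, by simp⟩ fun K ⟨hKA, hK⟩ L ⟨hLB, hL⟩ => ?_
  calc volume K + volume L ≤ volume (insert x K) + volume (insert y L) := by
        gcongr <;> exact subset_insert _ _
    _ ≤ volume (insert x K + insert y L) :=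
        volume_add_volume_le_of_isCompact (hK.insert x) (hL.insert y) (insert_nonempty _ _)
          (insert_nonempty _ _)
    _ ≤ volume (A + B) := by
        gcongr
        exacts [insert_subset hx hKA, insert_subset hy hLB]

lemma ofReal_mul_volume_add_le (ha : 0 < a) (hb : 0 < b) {A B C : Set ℝ} (hA : MeasurableSet A)
    (hB : MeasurableSet B) (hA₀ : A.Nonempty) (hB₀ : B.Nonempty)
    (hC : ∀ x ∈ A, ∀ y ∈ B, a * x + b * y ∈ C) :
    ENNReal.ofReal a * volume A + ENNReal.ofReal b * volume B ≤ volume C := by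
  have volume_smul {c : ℝ} (hc : 0 < c) (S : Set ℝ) :
      volume (c • S) = ENNReal.ofReal c * volume S := by
    rw [Measure.addHaar_smul, Module.finrank_self, pow_one, abs_of_pos hc]
  rw [← volume_smul ha, ← volume_smul hb]
  refine (volume_add_volume_le_volume_add (hA.const_smul₀ a) (hB.const_smul₀ b) hA₀.smul_set
    hB₀.smul_set).trans (measure_mono ?_)
  rintro _ ⟨_, ⟨x, hx, rfl⟩, _, ⟨y, hy, rfl⟩, rfl⟩
  exact hC x hx y hy

lemma ofReal_mul_lintegral_add_le_of_iSup_eq_one (ha : 0 < a) (hb : 0 < b) (hab : a + b = 1)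
    {u v h : ℝ → ℝ≥0∞} (hu : Measurable u) (hv : Measurable v) (hh : Measurable h)
    (hu₁ : ⨆ x, u x = 1) (hv₁ : ⨆ x, v x = 1)
    (huvh : ∀ x y, u x ^ a * v y ^ b ≤ h (a * x + b * y)) :
    ENNReal.ofReal a * (∫⁻ x, u x) + ENNReal.ofReal b * ∫⁻ x, v x ≤ ∫⁻ x, h x := by
  have hlevel (w : ℝ → ℝ≥0∞) : Measurable fun t : ℝ => volume {x | ENNReal.ofReal t < w x} :=
    Antitone.measurable fun s t hst =>
      measure_mono fun x hx => (ENNReal.ofReal_le_ofReal hst).trans_lt hx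
  rw [lintegral_eq_lintegral_measure_setOf_ofReal_lt hu,
    lintegral_eq_lintegral_measure_setOf_ofReal_lt hv,
    lintegral_eq_lintegral_measure_setOf_ofReal_lt hh]
  rw [← lintegral_const_mul _ (hlevel u), ← lintegral_const_mul _ (hlevel v),
    ← lintegral_add_left ((hlevel u).const_mul _)]
  refine lintegral_mono fun t => ?_
  rcases lt_or_ge (ENNReal.ofReal t) 1 with ht | ht
  · have hnonempty {w : ℝ → ℝ≥0∞} (hw : ⨆ x, w x = 1) : {x | ENNReal.ofReal t < w x}.Nonempty :=
      let ⟨x, hx⟩ := lt_iSup_iff.1 (ht.trans_eq hw.symm); ⟨x, hx⟩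
    refine ofReal_mul_volume_add_le ha hb (measurableSet_lt measurable_const hu)
      (measurableSet_lt measurable_const hv) (hnonempty hu₁) (hnonempty hv₁) fun x hx y hy => ?_
    calc ENNReal.ofReal t = ENNReal.ofReal t ^ a * ENNReal.ofReal t ^ b := by
          rw [← ENNReal.rpow_add_of_nonneg _ _ ha.le hb.le, hab, ENNReal.rpow_one]
      _ < u x ^ a * v y ^ b :=
          ENNReal.mul_lt_mul (ENNReal.rpow_lt_rpow hx ha) (ENNReal.rpow_lt_rpow hy hb)
      _ ≤ h (a * x + b * y) := huvh x y
  · have hempty {w : ℝ → ℝ≥0∞} (hw : ⨆ x, w x = 1) : {x | ENNReal.ofReal t < w x} = ∅ :=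
      eq_empty_of_forall_notMem fun x hx => (((le_iSup w x).trans hw.le).trans ht).not_gt hx
    simp [hempty hu₁, hempty hv₁]

lemma prekopaLeindler_real_of_iSup_ne_top (ha : 0 < a) (hb : 0 < b) (hab : a + b = 1)
    {u v h : ℝ → ℝ≥0∞} (hu : Measurable u) (hv : Measurable v) (hh : Measurable h)
    (hu_top : ⨆ x, u x ≠ ⊤) (hv_top : ⨆ x, v x ≠ ⊤)
    (huvh : ∀ x y, u x ^ a * v y ^ b ≤ h (a * x + b * y)) :
    (∫⁻ x, u x) ^ a * (∫⁻ x, v x) ^ b ≤ ∫⁻ x, h x := by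
  rcases eq_or_ne (⨆ x, u x) 0 with hu₀ | hu₀
  · simp [funext fun x => ENNReal.iSup_eq_zero.1 hu₀ x, ha]
  rcases eq_or_ne (⨆ x, v x) 0 with hv₀ | hv₀
  · simp [funext fun x => ENNReal.iSup_eq_zero.1 hv₀ x, hb]
  set U := ⨆ x, u x
  set V := ⨆ x, v x
  have hUa : U ^ a ≠ 0 ∧ U ^ a ≠ ⊤ := by simp [hu₀, hu_top, ha]
  have hVb : V ^ b ≠ 0 ∧ V ^ b ≠ ⊤ := by simp [hv₀, hv_top, hb]
  have div_rpow_mul (s t : ℝ≥0∞) : (s / U) ^ a * (t / V) ^ b = s ^ a * t ^ b / (U ^ a * V ^ b) := by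
    rw [ENNReal.div_rpow_of_nonneg _ _ ha.le, ENNReal.div_rpow_of_nonneg _ _ hb.le,
      ENNReal.mul_div_mul_comm (.inl hUa.1) (.inl hUa.2)]
  have normalized := ofReal_mul_lintegral_add_le_of_iSup_eq_one ha hb hab (hu.div_const U)
    (hv.div_const V) (hh.div_const (U ^ a * V ^ b))
    (by rw [← ENNReal.iSup_div, ENNReal.div_self hu₀ hu_top])
    (by rw [← ENNReal.iSup_div, ENNReal.div_self hv₀ hv_top])
    fun x y => by rw [div_rpow_mul]; gcongr; exact huvh x y
  have lintegral_div {w : ℝ → ℝ≥0∞} (hw : Measurable w) (c : ℝ≥0∞) :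
      ∫⁻ x, w x / c = (∫⁻ x, w x) / c := by
    simp only [div_eq_mul_inv, lintegral_mul_const _ hw]
  rw [lintegral_div hu, lintegral_div hv, lintegral_div hh] at normalized
  have := (rpow_mul_rpow_le_add ha hb hab _ _).trans normalized
  rw [div_rpow_mul, ENNReal.div_le_iff (mul_ne_zero hUa.1 hVb.1) (ENNReal.mul_ne_top hUa.2 hVb.2),
    ENNReal.div_mul_cancel (mul_ne_zero hUa.1 hVb.1) (ENNReal.mul_ne_top hUa.2 hVb.2)] at this
  exact this

lemma prekopaLeindler_real (ha : 0 < a) (hb : 0 < b) (hab : a + b = 1)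
    {u v h : ℝ → ℝ≥0∞} (hu : Measurable u) (hv : Measurable v) (hh : Measurable h)
    (huvh : ∀ x y, u x ^ a * v y ^ b ≤ h (a * x + b * y)) :
    (∫⁻ x, u x) ^ a * (∫⁻ x, v x) ^ b ≤ ∫⁻ x, h x := by
  have hbdd (w : ℝ → ℝ≥0∞) (N : ℕ) : ⨆ x, min (w x) N ≠ ⊤ :=
    ne_top_of_le_ne_top (ENNReal.natCast_ne_top N) (iSup_le fun x => min_le_right _ _)
  rcases eq_or_ne (∫⁻ x, u x) 0 with hu₀ | hu₀
  · simp [hu₀, ha]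
  rcases eq_or_ne (∫⁻ x, v x) 0 with hv₀ | hv₀
  · simp [hv₀, hb]
  have hlim {w : ℝ → ℝ≥0∞} (hw : Measurable w) (c : ℝ) :
      Tendsto (fun N : ℕ => (∫⁻ x, min (w x) N) ^ c) atTop (𝓝 ((∫⁻ x, w x) ^ c)) :=
    (ENNReal.continuous_rpow_const.tendsto _).comp (tendsto_lintegral_min_natCast hw)
  refine le_of_tendsto (ENNReal.Tendsto.mul (hlim hu a) (.inl (by simp [hu₀, ha, ha.le]))
    (hlim hv b) (.inl (by simp [hv₀, hb, hb.le]))) (.of_forall fun N => ?_)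
  refine prekopaLeindler_real_of_iSup_ne_top ha hb hab (hu.min measurable_const)
    (hv.min measurable_const) hh (hbdd u N) (hbdd v N) fun x y => le_trans ?_ (huvh x y)
  gcongr <;> exact min_le_left _ _

lemma measurable_finCons {n : ℕ} :
    Measurable fun p : ℝ × (Fin n → ℝ) => (Fin.cons p.1 p.2 : Fin (n + 1) → ℝ) := by
  refine measurable_pi_iff.2 (Fin.cases ?_ fun i => ?_)
  · simpa using measurable_fst
  · simp only [Fin.cons_succ]
    fun_prop

lemma lintegral_pi_succ {n : ℕ} {u : (Fin (n + 1) → ℝ) → ℝ≥0∞} (hu : Measurable u) :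
    ∫⁻ x, u x = ∫⁻ s : ℝ, ∫⁻ y : Fin n → ℝ, u (Fin.cons s y) := by
  have h := (volume_preserving_piFinSuccAbove (fun _ : Fin (n + 1) => ℝ) 0).symm
  rw [← h.lintegral_comp hu, Measure.volume_eq_prod, lintegral_prod]
  · simp [MeasurableEquiv.piFinSuccAbove_symm_apply, Fin.insertNthEquiv]
  · exact (hu.comp (MeasurableEquiv.measurable _)).aemeasurable

theorem prekopaLeindler (ha : 0 < a) (hb : 0 < b) (hab : a + b = 1) {n : ℕ}
    {u v h : (Fin n → ℝ) → ℝ≥0∞} (hu : Measurable u) (hv : Measurable v) (hh : Measurable h)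
    (huvh : ∀ x y, u x ^ a * v y ^ b ≤ h (a • x + b • y)) :
    (∫⁻ x, u x) ^ a * (∫⁻ x, v x) ^ b ≤ ∫⁻ x, h x := by
  induction n with
  | zero =>
    simp only [lintegral_unique, measure_univ, Measure.volume_pi_eq_dirac (0 : Fin 0 → ℝ), mul_one]
    convert huvh default default
  | succ n ih =>
    have hslice {w : (Fin (n + 1) → ℝ) → ℝ≥0∞} (hw : Measurable w) (s : ℝ) :
        Measurable fun y : Fin n → ℝ => w (Fin.cons s y) :=
      (hw.comp measurable_finCons).comp measurable_prodMk_left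
    have hmarginal {w : (Fin (n + 1) → ℝ) → ℝ≥0∞} (hw : Measurable w) :
        Measurable fun s : ℝ => ∫⁻ y : Fin n → ℝ, w (Fin.cons s y) :=
      (hw.comp measurable_finCons).lintegral_prod_right'
    rw [lintegral_pi_succ hu, lintegral_pi_succ hv, lintegral_pi_succ hh]
    refine prekopaLeindler_real ha hb hab (hmarginal hu) (hmarginal hv) (hmarginal hh) fun s t =>
      ih (hslice hu s) (hslice hv t) (hslice hh _) fun x y => (huvh _ _).trans_eq ?_
    congr 1
    ext i
    refine Fin.cases ?_ (fun j => ?_) i <;> simp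

end PrekopaLeindler

section ExponentialMoments

variable {α : Type*} [MeasurableSpace α] {ν : Measure α} [IsFiniteMeasure ν]

lemma one_add_sq_div_two_le_cosh (x : ℝ) : 1 + x ^ 2 / 2 ≤ Real.cosh x := by
  have hsinh : |x / 2| ≤ |Real.sinh (x / 2)| := by
    rw [Real.abs_sinh]
    exact Real.self_le_sinh_iff.2 (abs_nonneg _)
  calc 1 + x ^ 2 / 2 = 1 + 2 * (x / 2) ^ 2 := by ring
    _ ≤ 1 + 2 * Real.sinh (x / 2) ^ 2 := by
        have := sq_le_sq.2 hsinh
        gcongr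
    _ = Real.cosh (2 * (x / 2)) := by
        rw [Real.cosh_two_mul, Real.cosh_sq']
        ring
    _ = Real.cosh x := by rw [mul_div_cancel₀ x two_ne_zero]

lemma integrable_exp_of_abs_le {g : α → ℝ} {C : ℝ} (hg : AEStronglyMeasurable g ν)
    (hgC : ∀ᵐ x ∂ν, |g x| ≤ C) : Integrable (fun x => Real.exp (g x)) ν := by
  refine .of_bound (Real.continuous_exp.comp_aestronglyMeasurable hg) (Real.exp C) ?_
  filter_upwards [hgC] with x hx
  rw [Real.norm_eq_abs, Real.abs_exp]
  exact Real.exp_le_exp.2 ((le_abs_self _).trans hx)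

lemma sq_measureReal_add_le_integral_exp_mul_integral_exp_neg {g : α → ℝ} (hg : MemLp g 2 ν)
    (hexp : Integrable (fun x => Real.exp (g x)) ν)
    (hexp_neg : Integrable (fun x => Real.exp (-g x)) ν) :
    ν.real univ ^ 2 + (ν.real univ * (∫ x, g x ^ 2 ∂ν) - (∫ x, g x ∂ν) ^ 2) ≤
      (∫ x, Real.exp (g x) ∂ν) * ∫ x, Real.exp (-g x) ∂ν := by
  have hg₁ : Integrable g ν := hg.integrable one_le_two
  have hg₂ : Integrable (fun x => g x ^ 2) ν := hg.integrable_sq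
  have hone : Integrable (fun _ : α => (1 : ℝ)) ν := integrable_const 1
  have hsq : Integrable (fun p : α × α => g p.1 ^ 2 * 1 + 1 * g p.2 ^ 2) (ν.prod ν) :=
    (hg₂.mul_prod hone).add (hone.mul_prod hg₂)
  have hquad : Integrable (fun p : α × α => 1 * 1 + (g p.1 ^ 2 * 1 + 1 * g p.2 ^ 2) / 2)
      (ν.prod ν) := (hone.mul_prod hone).add (hsq.div_const 2)
  have hexps : Integrable (fun p : α × α => Real.exp (g p.1) * Real.exp (-g p.2)
      + Real.exp (-g p.1) * Real.exp (g p.2)) (ν.prod ν) :=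
    (hexp.mul_prod hexp_neg).add (hexp_neg.mul_prod hexp)
  calc ν.real univ ^ 2 + (ν.real univ * (∫ x, g x ^ 2 ∂ν) - (∫ x, g x ∂ν) ^ 2)
      = ∫ p : α × α, (1 * 1 + (g p.1 ^ 2 * 1 + 1 * g p.2 ^ 2) / 2 - g p.1 * g p.2)
          ∂(ν.prod ν) := by
        rw [integral_sub hquad (hg₁.mul_prod hg₁), integral_add (hone.mul_prod hone)
          (hsq.div_const 2), integral_div, integral_add (hg₂.mul_prod hone) (hone.mul_prod hg₂),
          integral_prod_mul g g, integral_prod_mul (fun x => g x ^ 2) fun _ => (1 : ℝ),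
          integral_prod_mul (fun _ => (1 : ℝ)) fun x => g x ^ 2,
          integral_prod_mul (fun _ => (1 : ℝ)) fun _ => (1 : ℝ)]
        simp only [integral_const, smul_eq_mul, mul_one]
        ring
    _ ≤ ∫ p : α × α, (Real.exp (g p.1) * Real.exp (-g p.2)
          + Real.exp (-g p.1) * Real.exp (g p.2)) / 2 ∂(ν.prod ν) := by
        refine integral_mono (hquad.sub (hg₁.mul_prod hg₁)) (hexps.div_const 2) fun p => ?_
        have := one_add_sq_div_two_le_cosh (g p.1 - g p.2)
        rw [Real.cosh_eq, sub_eq_add_neg (g p.1), Real.exp_add, neg_add, neg_neg,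
          Real.exp_add] at this
        linarith
    _ = (∫ x, Real.exp (g x) ∂ν) * ∫ x, Real.exp (-g x) ∂ν := by
        rw [integral_div, integral_add (hexp.mul_prod hexp_neg) (hexp_neg.mul_prod hexp),
          integral_prod_mul (fun x => Real.exp (g x)) fun x => Real.exp (-g x),
          integral_prod_mul (fun x => Real.exp (-g x)) fun x => Real.exp (g x)]
        ring

lemma integral_exp_mul_le {r : α → ℝ} {s K : ℝ} (hs : 0 ≤ s) (hr : Integrable r ν)
    (hr₀ : ∀ᵐ x ∂ν, 0 ≤ r x) (hrK : ∀ᵐ x ∂ν, r x ≤ K) :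
    ∫ x, Real.exp (s * r x) ∂ν ≤ ν.real univ + s * Real.exp (s * K) * ∫ x, r x ∂ν := by
  calc ∫ x, Real.exp (s * r x) ∂ν ≤ ∫ x, (1 + s * Real.exp (s * K) * r x) ∂ν := by
        refine integral_mono_of_nonneg (.of_forall fun x => (Real.exp_pos _).le)
          ((integrable_const _).add (hr.const_mul _)) ?_
        filter_upwards [hr₀, hrK] with x h₀ hK
        have hexp : Real.exp (s * r x) ≤ 1 + s * r x * Real.exp (s * r x) := by
          have := mul_le_mul_of_nonneg_right (Real.add_one_le_exp (-(s * r x)))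
            (Real.exp_pos (s * r x)).le
          rw [← Real.exp_add, neg_add_cancel, Real.exp_zero] at this
          linarith
        calc Real.exp (s * r x) ≤ 1 + s * r x * Real.exp (s * r x) := hexp
          _ ≤ 1 + s * r x * Real.exp (s * K) := by gcongr
          _ = 1 + s * Real.exp (s * K) * r x := by ring
    _ = ν.real univ + s * Real.exp (s * K) * ∫ x, r x ∂ν := by
        rw [integral_add (integrable_const _) (hr.const_mul _), integral_const_mul]
        simp

lemma tendsto_integral_max_of_eventually_le {q : α → ℝ} {r : ℝ → α → ℝ} {l : Filter ℝ}
    [l.IsCountablyGenerated] {K : ℝ} (hq : AEStronglyMeasurable q ν) (hq₀ : ∀ᵐ x ∂ν, 0 ≤ q x)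
    (hqK : ∀ᵐ x ∂ν, q x ≤ K) (hr : ∀ᶠ t in l, AEStronglyMeasurable (r t) ν)
    (hrK : ∀ᶠ t in l, ∀ᵐ x ∂ν, r t x ≤ K)
    (hlim : ∀ᵐ x ∂ν, ∀ ε > 0, ∀ᶠ t in l, r t x ≤ q x + ε) :
    Tendsto (fun t => ∫ x, max (r t x) (q x) ∂ν) l (𝓝 (∫ x, q x ∂ν)) := by
  refine tendsto_integral_filter_of_dominated_convergence (fun _ => K) (hr.mono fun t ht =>
    ht.sup hq) (hrK.mono fun t ht => ?_) (integrable_const _) ?_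
  · filter_upwards [ht, hqK, hq₀] with x h₁ h₂ h₀
    rw [Real.norm_of_nonneg (h₀.trans (le_max_right _ _))]
    exact max_le h₁ h₂
  · filter_upwards [hlim] with x hx
    refine tendsto_order.2 ⟨fun c hc => .of_forall fun t => hc.trans_le (le_max_right _ _),
      fun c hc => ?_⟩
    filter_upwards [hx ((c - q x) / 2) (by linarith)] with t ht
    exact max_lt (by linarith) hc

lemma integral_exp_mul_le_of_integral_max {q r : α → ℝ} {s K : ℝ} (hs : 0 ≤ s)
    (hq : AEStronglyMeasurable q ν) (hq₀ : ∀ᵐ x ∂ν, 0 ≤ q x) (hqK : ∀ᵐ x ∂ν, q x ≤ K)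
    (hr : AEStronglyMeasurable r ν) (hrK : ∀ᵐ x ∂ν, r x ≤ K) :
    ∫ x, Real.exp (s * r x) ∂ν ≤
      ν.real univ + s * (Real.exp (s * K) * ∫ x, max (r x) (q x) ∂ν) := by
  have hmax₀ : ∀ᵐ x ∂ν, 0 ≤ max (r x) (q x) := hq₀.mono fun x hx => hx.trans (le_max_right _ _)
  have hmaxK : ∀ᵐ x ∂ν, max (r x) (q x) ≤ K := by
    filter_upwards [hrK, hqK] with x h₁ h₂
    exact max_le h₁ h₂
  have hmax_int : Integrable (fun x => max (r x) (q x)) ν := by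
    refine .of_bound (hr.sup hq) K ?_
    filter_upwards [hmax₀, hmaxK] with x h₀ hK
    rwa [Real.norm_of_nonneg h₀]
  have hexp_int : Integrable (fun x => Real.exp (s * max (r x) (q x))) ν := by
    refine integrable_exp_of_abs_le (hmax_int.aestronglyMeasurable.const_mul _) (C := s * K) ?_
    filter_upwards [hmax₀, hmaxK] with x h₀ hK
    rw [abs_of_nonneg (mul_nonneg hs h₀)]
    exact mul_le_mul_of_nonneg_left hK hs
  calc ∫ x, Real.exp (s * r x) ∂ν ≤ ∫ x, Real.exp (s * max (r x) (q x)) ∂ν := by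
        refine integral_mono_of_nonneg (.of_forall fun x => (Real.exp_pos _).le) hexp_int
          (.of_forall fun x => ?_)
        dsimp only
        gcongr
        exact le_max_left _ _
    _ ≤ ν.real univ + s * (Real.exp (s * K) * ∫ x, max (r x) (q x) ∂ν) := by
        rw [← mul_assoc]
        exact integral_exp_mul_le hs hmax_int hmax₀ hmaxK

lemma sq_measureReal_add_sq_mul_le_integral_exp_mul_integral_exp_neg {g : α → ℝ} {C : ℝ}
    (hg : AEStronglyMeasurable g ν) (hgC : ∀ᵐ x ∂ν, |g x| ≤ C) (t : ℝ) :
    ν.real univ ^ 2 + t ^ 2 * (ν.real univ * (∫ x, g x ^ 2 ∂ν) - (∫ x, g x ∂ν) ^ 2) ≤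
      (∫ x, Real.exp (t * g x) ∂ν) * ∫ x, Real.exp (-(t * g x)) ∂ν := by
  have hbound : ∀ᵐ x ∂ν, |t * g x| ≤ |t| * C := hgC.mono fun x hx => by
    rw [abs_mul]
    gcongr
  have hmemLp : MemLp (fun x => t * g x) 2 ν := .of_bound (hg.const_mul t) (|t| * C) hbound
  have := sq_measureReal_add_le_integral_exp_mul_integral_exp_neg hmemLp
    (integrable_exp_of_abs_le (hg.const_mul t) hbound)
    (integrable_exp_of_abs_le (hg.const_mul t).neg (C := |t| * C) (by simpa using hbound))
  simp only [mul_pow, integral_const_mul] at this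
  linarith

lemma measureReal_mul_integral_sq_sub_le_of_integral_exp_mul_le {g q : α → ℝ} {r : ℝ → α → ℝ}
    {C K : ℝ} (hg : AEStronglyMeasurable g ν) (hgC : ∀ᵐ x ∂ν, |g x| ≤ C)
    (hq : AEStronglyMeasurable q ν) (hq₀ : ∀ᵐ x ∂ν, 0 ≤ q x) (hqK : ∀ᵐ x ∂ν, q x ≤ K)
    (hr : ∀ t > 0, AEStronglyMeasurable (r t) ν) (hrK : ∀ t > 0, ∀ᵐ x ∂ν, r t x ≤ K)
    (hlim : ∀ᵐ x ∂ν, ∀ ε > 0, ∀ᶠ t in 𝓝[>] 0, r t x ≤ q x + ε)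
    (hexp : ∀ t > 0, (∫ x, Real.exp (t * g x) ∂ν) * (∫ x, Real.exp (-(t * g x)) ∂ν) ≤
      (∫ x, Real.exp (t ^ 2 * r t x) ∂ν) ^ 2) :
    ν.real univ * (∫ x, g x ^ 2 ∂ν) - (∫ x, g x ∂ν) ^ 2 ≤ 2 * ν.real univ * ∫ x, q x ∂ν := by
  set M := ν.real univ
  have hpos : ∀ᶠ t : ℝ in 𝓝[>] 0, 0 < t := self_mem_nhdsWithin
  let R : ℝ → ℝ := fun t => Real.exp (t ^ 2 * K) * ∫ x, max (r t x) (q x) ∂ν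
  have hR : Tendsto R (𝓝[>] 0) (𝓝 (∫ x, q x ∂ν)) := by
    have hexp₀ : Tendsto (fun t : ℝ => Real.exp (t ^ 2 * K)) (𝓝[>] 0) (𝓝 1) := by
      have : Continuous fun t : ℝ => Real.exp (t ^ 2 * K) := by fun_prop
      simpa using (this.tendsto 0).mono_left nhdsWithin_le_nhds
    simpa using hexp₀.mul (tendsto_integral_max_of_eventually_le hq hq₀ hqK (hpos.mono hr)
      (hpos.mono hrK) hlim)
  have hlimit : Tendsto (fun t => 2 * M * R t + t ^ 2 * R t ^ 2) (𝓝[>] 0)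
      (𝓝 (2 * M * ∫ x, q x ∂ν)) := by
    have ht : Tendsto (fun t : ℝ => t ^ 2) (𝓝[>] 0) (𝓝 0) := by
      simpa using ((continuous_pow 2).tendsto (0 : ℝ)).mono_left nhdsWithin_le_nhds
    simpa using (hR.const_mul (2 * M)).add (ht.mul (hR.pow 2))
  refine ge_of_tendsto hlimit (hpos.mono fun t ht => ?_)
  have hupper : ∫ x, Real.exp (t ^ 2 * r t x) ∂ν ≤ M + t ^ 2 * R t :=
    integral_exp_mul_le_of_integral_max (sq_nonneg t) hq hq₀ hqK (hr t ht) (hrK t ht)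
  have hsq : M ^ 2 + t ^ 2 * (M * (∫ x, g x ^ 2 ∂ν) - (∫ x, g x ∂ν) ^ 2) ≤
      (M + t ^ 2 * R t) ^ 2 :=
    (sq_measureReal_add_sq_mul_le_integral_exp_mul_integral_exp_neg hg hgC t).trans
      ((hexp t ht).trans (pow_le_pow_left₀ (integral_nonneg fun x => (Real.exp_pos _).le) hupper 2))
  refine le_of_mul_le_mul_left ?_ (pow_pos ht 2)
  linarith

end ExponentialMoments

section SupConvolution

variable {n : ℕ}

/-- The functional maximized over `e` in the rescaled sup-convolution `supConv` of `G` with respect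
to the quadratic forms `∑ i, w i z * e i ^ 2`. -/
noncomputable def supConvObjective (w : Fin n → (Fin n → ℝ) → ℝ) (G : (Fin n → ℝ) → ℝ) (t : ℝ)
    (z e : Fin n → ℝ) : ℝ :=
  (G (z + t • e) - G (z - t • e)) / (2 * t) - (∑ i, w i z * e i ^ 2) / 2

/-- The rescaled sup-convolution of `G`: the smallest function which can serve as `r` when
Prékopa–Leindler is applied to `exp (t * G)`, `exp (-t * G)` and `exp (t ^ 2 * r)` with respect to a
density whose potential has Hessian at least `w`. Where `G` is differentiable, it tends to
`(∑ i, (∂ᵢ G) ^ 2 / w i) / 2` as `t → 0`. -/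
noncomputable def supConv (w : Fin n → (Fin n → ℝ) → ℝ) (G : (Fin n → ℝ) → ℝ) (t : ℝ)
    (z : Fin n → ℝ) : ℝ :=
  ⨆ e, supConvObjective w G t z e

variable {w : Fin n → (Fin n → ℝ) → ℝ} {G : (Fin n → ℝ) → ℝ} {L : ℝ≥0} {c t : ℝ}

lemma measurable_supConv (hw : ∀ i, Measurable (w i)) (hG : Continuous G) :
    Measurable (supConv w G t) := by
  obtain ⟨S, hS_countable, hS_dense⟩ := TopologicalSpace.exists_countable_dense (Fin n → ℝ)
  have : Countable S := hS_countable
  have hcont (z : Fin n → ℝ) : Continuous (supConvObjective w G t z) := by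
    unfold supConvObjective
    fun_prop
  have heq : supConv w G t = fun z => ⨆ e : S, supConvObjective w G t z e :=
    funext fun z => (hS_dense.ciSup' (hcont z)).symm
  rw [heq]
  refine Measurable.iSup fun e => ?_
  unfold supConvObjective
  fun_prop

lemma sq_norm_le_sum_sq (e : Fin n → ℝ) : ‖e‖ ^ 2 ≤ ∑ i, e i ^ 2 := by
  have hsum : 0 ≤ ∑ i, e i ^ 2 := Finset.sum_nonneg fun i _ => sq_nonneg _
  rw [← Real.le_sqrt (norm_nonneg e) hsum, pi_norm_le_iff_of_nonneg (Real.sqrt_nonneg _)]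
  exact fun i => Real.abs_le_sqrt (Finset.single_le_sum (f := fun i => e i ^ 2)
    (fun i _ => sq_nonneg _) (Finset.mem_univ i))

lemma supConvObjective_le (hw : ∀ i z, c ≤ w i z) (hc : 0 ≤ c) (hG : LipschitzWith L G)
    (ht : 0 < t) (z e : Fin n → ℝ) : supConvObjective w G t z e ≤ L * ‖e‖ - c * ‖e‖ ^ 2 / 2 := by
  have hdiff : (G (z + t • e) - G (z - t • e)) / (2 * t) ≤ L * ‖e‖ := by
    rw [div_le_iff₀ (by positivity)]
    calc G (z + t • e) - G (z - t • e) ≤ L * ‖(z + t • e) - (z - t • e)‖ := by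
          rw [← dist_eq_norm]
          exact (le_abs_self _).trans (hG.dist_le_mul _ _)
      _ = L * ‖e‖ * (2 * t) := by
          rw [show (z + t • e) - (z - t • e) = (2 * t) • e by module, norm_smul,
            Real.norm_of_nonneg (by positivity)]
          ring
  have hquad : c * ‖e‖ ^ 2 ≤ ∑ i, w i z * e i ^ 2 := by
    calc c * ‖e‖ ^ 2 ≤ c * ∑ i, e i ^ 2 := by gcongr; exact sq_norm_le_sum_sq e
      _ ≤ ∑ i, w i z * e i ^ 2 := by
          rw [Finset.mul_sum]
          gcongr with i
          exact hw i z
  unfold supConvObjective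
  linarith

lemma mul_sub_mul_sq_div_two_le {s : ℝ} (hs : 0 < s) (p x : ℝ) :
    p * x - s * x ^ 2 / 2 ≤ p ^ 2 / s / 2 := by
  rw [div_div, le_div_iff₀ (by positivity)]
  nlinarith [sq_nonneg (p - s * x)]

lemma supConvObjective_le_sq_div (hw : ∀ i z, c ≤ w i z) (hc : 0 < c) (hG : LipschitzWith L G)
    (ht : 0 < t) (z e : Fin n → ℝ) : supConvObjective w G t z e ≤ L ^ 2 / c / 2 :=
  (supConvObjective_le hw hc.le hG ht z e).trans (mul_sub_mul_sq_div_two_le hc _ _)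

lemma supConv_le (hw : ∀ i z, c ≤ w i z) (hc : 0 < c) (hG : LipschitzWith L G) (ht : 0 < t)
    (z : Fin n → ℝ) : supConv w G t z ≤ L ^ 2 / c / 2 :=
  ciSup_le fun e => supConvObjective_le_sq_div hw hc hG ht z e

lemma supConvObjective_le_supConv (hw : ∀ i z, c ≤ w i z) (hc : 0 < c) (hG : LipschitzWith L G)
    (ht : 0 < t) (z e : Fin n → ℝ) : supConvObjective w G t z e ≤ supConv w G t z :=
  le_ciSup ⟨L ^ 2 / c / 2, forall_mem_range.2 (supConvObjective_le_sq_div hw hc hG ht z)⟩ e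

lemma supConv_nonneg (hw : ∀ i z, c ≤ w i z) (hc : 0 < c) (hG : LipschitzWith L G) (ht : 0 < t)
    (z : Fin n → ℝ) : 0 ≤ supConv w G t z := by
  simpa [supConvObjective] using supConvObjective_le_supConv hw hc hG ht z 0

lemma fderiv_apply_eq_sum_partialD {z : Fin n → ℝ} (hz : DifferentiableAt ℝ G z)
    (e : Fin n → ℝ) : fderiv ℝ G z e = ∑ i, partialD i G z * e i := by
  rw [← ContinuousLinearMap.coe_coe, LinearMap.pi_apply_eq_sum_univ]
  refine Finset.sum_congr rfl fun i _ => ?_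
  have hbasis : (fun j => if i = j then 1 else 0 : Fin n → ℝ) = Pi.single i 1 := by
    ext j
    simp only [Pi.single_apply, eq_comm]
  rw [hbasis, smul_eq_mul, mul_comm, partialD, hz.lineDeriv_eq_fderiv, ContinuousLinearMap.coe_coe]

lemma eventually_symmetric_quotient_le {E : Type*} [NormedAddCommGroup E] [NormedSpace ℝ E]
    {F : E → ℝ} {z : E} (hz : DifferentiableAt ℝ F z) {ε : ℝ} (hε : 0 < ε) (R : ℝ) :
    ∀ᶠ t in 𝓝[>] (0 : ℝ), ∀ e, ‖e‖ ≤ R →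
      (F (z + t • e) - F (z - t • e)) / (2 * t) ≤ fderiv ℝ F z e + ε := by
  have hR : 0 < |R| + 1 := by positivity
  obtain ⟨η, hη, hball⟩ := Metric.eventually_nhds_iff.1
    (hz.hasFDerivAt.isLittleO.def (div_pos hε hR))
  have hsmall : ∀ᶠ t : ℝ in 𝓝[>] 0, t < η / (|R| + 1) :=
    nhdsWithin_le_nhds (Iio_mem_nhds (div_pos hη hR))
  filter_upwards [hsmall, self_mem_nhdsWithin] with t ht (ht₀ : 0 < t) e he
  have heR : ‖e‖ ≤ |R| + 1 := by linarith [le_abs_self R]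
  have hte : ‖t • e‖ ≤ t * (|R| + 1) := by
    rw [norm_smul, Real.norm_of_nonneg ht₀.le]
    gcongr
  have hteη : ‖t • e‖ < η := hte.trans_lt ((lt_div_iff₀ hR).1 ht)
  have hεt : ε / (|R| + 1) * ‖t • e‖ ≤ ε * t := by
    calc ε / (|R| + 1) * ‖t • e‖ ≤ ε / (|R| + 1) * (t * (|R| + 1)) := by gcongr
      _ = ε * t := by field_simp
  have hplus := hball (y := z + t • e) (by simpa [dist_eq_norm] using hteη)
  have hminus := hball (y := z - t • e) (by simpa [dist_eq_norm] using hteη)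
  simp only [add_sub_cancel_left, sub_sub_cancel_left, map_neg, map_smul, norm_neg, smul_eq_mul,
    Real.norm_eq_abs] at hplus hminus
  rw [div_le_iff₀ (by positivity)]
  linarith [(abs_le.1 hplus).2, (abs_le.1 hminus).1]

lemma eventually_supConv_le (hw : ∀ i z, c ≤ w i z) (hc : 0 < c) (hG : LipschitzWith L G)
    {z : Fin n → ℝ} (hz : DifferentiableAt ℝ G z) {ε : ℝ} (hε : 0 < ε) :
    ∀ᶠ t in 𝓝[>] 0, supConv w G t z ≤ (∑ i, partialD i G z ^ 2 / w i z) / 2 + ε := by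
  have hw₀ (i : Fin n) : 0 < w i z := hc.trans_le (hw i z)
  filter_upwards [eventually_symmetric_quotient_le hz hε (2 * L / c), self_mem_nhdsWithin]
    with t ht (ht₀ : 0 < t)
  refine ciSup_le fun e => ?_
  rcases le_or_gt ‖e‖ (2 * L / c) with he | he
  · calc supConvObjective w G t z e
        ≤ ∑ i, (partialD i G z * e i - w i z * e i ^ 2 / 2) + ε := by
          have := ht e he
          rw [fderiv_apply_eq_sum_partialD hz] at this
          rw [Finset.sum_sub_distrib, ← Finset.sum_div]
          unfold supConvObjective
          linarith
      _ ≤ (∑ i, partialD i G z ^ 2 / w i z) / 2 + ε := by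
          rw [Finset.sum_div]
          gcongr with i
          exact mul_sub_mul_sq_div_two_le (hw₀ i) _ _
  · have hLe : 2 * L ≤ c * ‖e‖ := ((div_lt_iff₀' hc).1 he).le
    calc supConvObjective w G t z e ≤ L * ‖e‖ - c * ‖e‖ ^ 2 / 2 :=
          supConvObjective_le hw hc.le hG ht₀ z e
      _ ≤ 0 := by nlinarith [norm_nonneg e]
      _ ≤ (∑ i, partialD i G z ^ 2 / w i z) / 2 + ε := by
          have : 0 ≤ ∑ i, partialD i G z ^ 2 / w i z :=
            Finset.sum_nonneg fun i _ => div_nonneg (sq_nonneg _) (hw₀ i).le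
          linarith

end SupConvolution

section BrascampLieb

variable {n : ℕ}

/-- The measure on `Ω` with density `exp (-W)` with respect to Lebesgue measure. -/
noncomputable def gibbsMeasure (Ω : Set (Fin n → ℝ)) (W : (Fin n → ℝ) → ℝ) :
    Measure (Fin n → ℝ) :=
  (volume.restrict Ω).withDensity fun x => ENNReal.ofReal (Real.exp (-W x))

/-- The Hessian of `W` on `Ω` is at least the diagonal matrix with entries `w i`, in a form that
involves no smoothness of `W`: all symmetric second differences, not only infinitesimal ones, are
bounded below through the value of `w` at the midpoint. -/
def HessianGEDiagonalOn (Ω : Set (Fin n → ℝ)) (W : (Fin n → ℝ) → ℝ)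
    (w : Fin n → (Fin n → ℝ) → ℝ) : Prop :=
  ∀ z v, z + v ∈ Ω → z - v ∈ Ω → 2 * W z + ∑ i, w i z * v i ^ 2 ≤ W (z + v) + W (z - v)

variable {B Ω : Set (Fin n → ℝ)} {W : (Fin n → ℝ) → ℝ} {w : Fin n → (Fin n → ℝ) → ℝ}
  {G : (Fin n → ℝ) → ℝ} {L : ℝ≥0} {c t : ℝ}

lemma gibbsMeasure_absolutelyContinuous : gibbsMeasure Ω W ≪ volume.restrict Ω :=
  withDensity_absolutelyContinuous _ _

lemma ae_gibbsMeasure_mem (hΩ : MeasurableSet Ω) : ∀ᵐ x ∂gibbsMeasure Ω W, x ∈ Ω :=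
  gibbsMeasure_absolutelyContinuous.ae_le (ae_restrict_mem hΩ)

lemma restrict_gibbsMeasure (hB : MeasurableSet B) (hBΩ : B ⊆ Ω) :
    (gibbsMeasure Ω W).restrict B = gibbsMeasure B W := by
  rw [gibbsMeasure, restrict_withDensity hB, Measure.restrict_restrict_of_subset hBΩ, gibbsMeasure]

lemma gibbsMeasure_congr {W' : (Fin n → ℝ) → ℝ} (hΩ : MeasurableSet Ω) (h : EqOn W W' Ω) :
    gibbsMeasure Ω W = gibbsMeasure Ω W' := by
  refine withDensity_congr_ae ?_
  filter_upwards [ae_restrict_mem hΩ] with x hx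
  rw [h hx]

lemma lintegral_gibbsMeasure (hΩ : MeasurableSet Ω) (hW : ContinuousOn W Ω)
    (F : (Fin n → ℝ) → ℝ≥0∞) :
    ∫⁻ x, F x ∂gibbsMeasure Ω W = ∫⁻ x in Ω, ENNReal.ofReal (Real.exp (-W x)) * F x :=
  lintegral_withDensity_eq_lintegral_mul_non_measurable₀ _
    (hW.neg.rexp.aemeasurable hΩ).ennreal_ofReal (.of_forall fun _ => ENNReal.ofReal_lt_top) F

lemma isFiniteMeasure_gibbsMeasure (hB : MeasurableSet B) (hB_bdd : Bornology.IsBounded B) {C : ℝ}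
    (hWC : ∀ x ∈ B, C ≤ W x) : IsFiniteMeasure (gibbsMeasure B W) := by
  refine isFiniteMeasure_withDensity (ne_of_lt ?_)
  calc ∫⁻ x in B, ENNReal.ofReal (Real.exp (-W x))
      ≤ ∫⁻ _ in B, ENNReal.ofReal (Real.exp (-C)) := by
        refine setLIntegral_mono' hB fun x hx => ?_
        gcongr
        exact hWC x hx
    _ < ⊤ := by
        rw [setLIntegral_const]
        exact ENNReal.mul_lt_top ENNReal.ofReal_lt_top hB_bdd.measure_lt_top

lemma lintegral_exp_gibbsMeasure (hB : MeasurableSet B) (hW : Measurable W)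
    {F : (Fin n → ℝ) → ℝ} (hF : Measurable F) :
    ∫⁻ x, ENNReal.ofReal (Real.exp (F x)) ∂gibbsMeasure B W =
      ∫⁻ x, B.indicator (fun x => ENNReal.ofReal (Real.exp (F x - W x))) x := by
  rw [gibbsMeasure, lintegral_withDensity_eq_lintegral_mul _ (by fun_prop) (by fun_prop),
    lintegral_indicator hB]
  simp only [Pi.mul_apply, sub_eq_neg_add, Real.exp_add, ENNReal.ofReal_mul (Real.exp_pos _).le]

lemma ennreal_rpow_half_mul_le_iff {x y z : ℝ≥0∞} :
    x ^ (1 / 2 : ℝ) * y ^ (1 / 2 : ℝ) ≤ z ↔ x * y ≤ z ^ 2 := by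
  rw [← ENNReal.mul_rpow_of_nonneg _ _ (by norm_num), one_div,
    ENNReal.rpow_inv_le_iff (by norm_num), ENNReal.rpow_two]

lemma prekopaLeindler_midpoint {u v h : (Fin n → ℝ) → ℝ≥0∞} (hu : Measurable u)
    (hv : Measurable v) (hh : Measurable h)
    (huvh : ∀ z e, u (z + e) * v (z - e) ≤ h z ^ 2) :
    (∫⁻ x, u x) * (∫⁻ x, v x) ≤ (∫⁻ x, h x) ^ 2 := by
  rw [← ennreal_rpow_half_mul_le_iff]
  refine prekopaLeindler (by norm_num) (by norm_num) (by norm_num) hu hv hh fun x y => ?_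
  rw [ennreal_rpow_half_mul_le_iff]
  convert huvh ((1 / 2 : ℝ) • x + (1 / 2 : ℝ) • y) ((1 / 2 : ℝ) • (x - y)) using 3 <;> module

lemma mul_sub_le_sq_mul_supConv (hw : ∀ i z, c ≤ w i z) (hc : 0 < c) (hG : LipschitzWith L G)
    (ht : 0 < t) (z v : Fin n → ℝ) :
    t * (G (z + v) - G (z - v)) - ∑ i, w i z * v i ^ 2 ≤ 2 * (t ^ 2 * supConv w G t z) := by
  have hsup := supConvObjective_le_supConv hw hc hG ht z (t⁻¹ • v)
  have hobj : t * (G (z + v) - G (z - v)) - ∑ i, w i z * v i ^ 2 =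
      2 * (t ^ 2 * supConvObjective w G t z (t⁻¹ • v)) := by
    simp only [supConvObjective, smul_inv_smul₀ ht.ne', Pi.smul_apply, smul_eq_mul, mul_pow,
      mul_left_comm _ (t⁻¹ ^ 2), ← Finset.mul_sum]
    field_simp
  rw [hobj]
  gcongr

lemma lintegral_exp_mul_lintegral_exp_neg_le (hB : MeasurableSet B) (hB_conv : Convex ℝ B)
    (hW : Measurable W) (hWw : HessianGEDiagonalOn B W w) (hw_meas : ∀ i, Measurable (w i))
    (hw : ∀ i z, c ≤ w i z) (hc : 0 < c) (hG : LipschitzWith L G) (ht : 0 < t) :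
    (∫⁻ x, ENNReal.ofReal (Real.exp (t * G x)) ∂gibbsMeasure B W) *
        (∫⁻ x, ENNReal.ofReal (Real.exp (-(t * G x))) ∂gibbsMeasure B W) ≤
      (∫⁻ x, ENNReal.ofReal (Real.exp (t ^ 2 * supConv w G t x)) ∂gibbsMeasure B W) ^ 2 := by
  have hGm : Measurable G := hG.continuous.measurable
  have hsm : Measurable (supConv w G t) := measurable_supConv hw_meas hG.continuous
  iterate 3 rw [lintegral_exp_gibbsMeasure hB hW (by fun_prop)]
  refine prekopaLeindler_midpoint (.indicator (by fun_prop) hB) (.indicator (by fun_prop) hB)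
    (.indicator (by fun_prop) hB) fun z v => ?_
  by_cases hp : z + v ∈ B
  swap
  · simp [hp]
  by_cases hm : z - v ∈ B
  swap
  · simp [hm]
  have hz : z ∈ B := by
    convert hB_conv hp hm (by norm_num : (0 : ℝ) ≤ 1 / 2) (by norm_num : (0 : ℝ) ≤ 1 / 2)
      (by norm_num) using 1
    module
  rw [indicator_of_mem hp, indicator_of_mem hm, indicator_of_mem hz,
    ← ENNReal.ofReal_mul (Real.exp_pos _).le, ← Real.exp_add,
    ← ENNReal.ofReal_pow (Real.exp_pos _).le, ← Real.exp_nat_mul]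
  gcongr
  push_cast
  linarith [mul_sub_le_sq_mul_supConv hw hc hG ht z v, hWw z v hp hm]

lemma abs_partialD_le (hG : LipschitzWith L G) (i : Fin n) (x : Fin n → ℝ) :
    |partialD i G x| ≤ L := by
  simpa [partialD, Pi.norm_single] using
    norm_lineDeriv_le_of_lipschitz ℝ hG (x₀ := x) (v := Pi.single i 1)

lemma sum_sq_partialD_div_le (hw : ∀ i z, c ≤ w i z) (hc : 0 < c) (hG : LipschitzWith L G)
    (z : Fin n → ℝ) : ∑ i, partialD i G z ^ 2 / w i z ≤ n * (L ^ 2 / c) := by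
  calc ∑ i, partialD i G z ^ 2 / w i z ≤ ∑ _i : Fin n, (L : ℝ) ^ 2 / c := by
        refine Finset.sum_le_sum fun i _ => div_le_div₀ (sq_nonneg _) ?_ hc (hw i z)
        exact sq_le_sq.2 ((abs_partialD_le hG i z).trans (le_abs_self _))
    _ = n * (L ^ 2 / c) := by simp

lemma exists_abs_le_of_isBounded (hG : LipschitzWith L G) (hB_bdd : Bornology.IsBounded B) :
    ∃ C, ∀ x ∈ B, |G x| ≤ C := by
  obtain ⟨C, hC⟩ := (hG.isBounded_image hB_bdd).exists_norm_le
  exact ⟨C, fun x hx => hC _ (mem_image_of_mem G hx)⟩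

lemma lintegral_exp_eq_ofReal {α : Type*} [MeasurableSpace α] {ν : Measure α} [IsFiniteMeasure ν]
    {F : α → ℝ} {C : ℝ} (hF : AEStronglyMeasurable F ν) (hFC : ∀ᵐ x ∂ν, |F x| ≤ C) :
    ∫⁻ x, ENNReal.ofReal (Real.exp (F x)) ∂ν = ENNReal.ofReal (∫ x, Real.exp (F x) ∂ν) :=
  (ofReal_integral_eq_lintegral_ofReal (integrable_exp_of_abs_le hF hFC)
    (.of_forall fun _ => (Real.exp_pos _).le)).symm

lemma integral_exp_mul_integral_exp_neg_le (hB : MeasurableSet B) (hB_conv : Convex ℝ B)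
    [IsFiniteMeasure (gibbsMeasure B W)] (hB_bdd : Bornology.IsBounded B)
    (hW : Measurable W) (hWw : HessianGEDiagonalOn B W w) (hw_meas : ∀ i, Measurable (w i))
    (hw : ∀ i z, c ≤ w i z) (hc : 0 < c) (hG : LipschitzWith L G) (ht : 0 < t) :
    (∫ x, Real.exp (t * G x) ∂gibbsMeasure B W) * (∫ x, Real.exp (-(t * G x)) ∂gibbsMeasure B W) ≤
      (∫ x, Real.exp (t ^ 2 * supConv w G t x) ∂gibbsMeasure B W) ^ 2 := by
  have hGm : Measurable G := hG.continuous.measurable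
  have hsm : Measurable (supConv w G t) := measurable_supConv hw_meas hG.continuous
  obtain ⟨C, hC⟩ := exists_abs_le_of_isBounded hG hB_bdd
  have htG : ∀ᵐ x ∂gibbsMeasure B W, |t * G x| ≤ t * C := by
    filter_upwards [ae_gibbsMeasure_mem hB] with x hx
    rw [abs_mul, abs_of_pos ht]
    gcongr
    exact hC x hx
  have hsup : ∀ᵐ x ∂gibbsMeasure B W, |t ^ 2 * supConv w G t x| ≤ t ^ 2 * (L ^ 2 / c / 2) := by
    refine .of_forall fun x => ?_
    rw [abs_of_nonneg (mul_nonneg (sq_nonneg t) (supConv_nonneg hw hc hG ht x))]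
    gcongr
    exact supConv_le hw hc hG ht x
  have hPL := lintegral_exp_mul_lintegral_exp_neg_le hB hB_conv hW hWw hw_meas hw hc hG ht
  rw [lintegral_exp_eq_ofReal (by fun_prop) htG,
    lintegral_exp_eq_ofReal (by fun_prop) (by simpa only [abs_neg] using htG),
    lintegral_exp_eq_ofReal (by fun_prop) hsup,
    ← ENNReal.ofReal_mul (integral_nonneg fun x => (Real.exp_pos _).le),
    ← ENNReal.ofReal_pow (integral_nonneg fun x => (Real.exp_pos _).le)] at hPL
  exact (ENNReal.ofReal_le_ofReal_iff (by positivity)).1 hPL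

lemma brascampLieb_of_lipschitzWith (hB : MeasurableSet B) (hB_conv : Convex ℝ B)
    (hB_bdd : Bornology.IsBounded B) [IsFiniteMeasure (gibbsMeasure B W)] (hW : Measurable W)
    (hWw : HessianGEDiagonalOn B W w) (hw_meas : ∀ i, Measurable (w i))
    (hw : ∀ i z, c ≤ w i z) (hc : 0 < c) (hG : LipschitzWith L G) :
    (gibbsMeasure B W).real univ * (∫ x, G x ^ 2 ∂gibbsMeasure B W) -
        (∫ x, G x ∂gibbsMeasure B W) ^ 2 ≤
      (gibbsMeasure B W).real univ *
        ∫ x, ∑ i, partialD i G x ^ 2 / w i x ∂gibbsMeasure B W := by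
  have hDm (i : Fin n) : Measurable (partialD i G) := measurable_lineDeriv hG.continuous
  let q : (Fin n → ℝ) → ℝ := fun x => (∑ i, partialD i G x ^ 2 / w i x) / 2
  have hq : Measurable q := (Finset.measurable_sum _ fun i _ => by fun_prop).div_const 2
  have hq₀ (x : Fin n → ℝ) : 0 ≤ q x :=
    div_nonneg (Finset.sum_nonneg fun i _ => div_nonneg (sq_nonneg _) (hc.le.trans (hw i x)))
      two_pos.le
  let K : ℝ := n * (L ^ 2 / c) / 2 + L ^ 2 / c / 2
  have hqK (x : Fin n → ℝ) : q x ≤ K :=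
    le_add_of_le_of_nonneg (div_le_div_of_nonneg_right (sum_sq_partialD_div_le hw hc hG x)
      two_pos.le) (by positivity)
  have hsupK (t : ℝ) (ht : 0 < t) (x : Fin n → ℝ) : supConv w G t x ≤ K :=
    le_add_of_nonneg_of_le (by positivity) (supConv_le hw hc hG ht x)
  have hlim : ∀ᵐ x ∂gibbsMeasure B W, ∀ ε > 0, ∀ᶠ t in 𝓝[>] 0, supConv w G t x ≤ q x + ε := by
    have hdiff : ∀ᵐ x ∂gibbsMeasure B W, DifferentiableAt ℝ G x :=
      (gibbsMeasure_absolutelyContinuous.trans Measure.absolutelyContinuous_restrict).ae_le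
        hG.ae_differentiableAt
    filter_upwards [hdiff] with x hx ε hε using eventually_supConv_le hw hc hG hx hε
  obtain ⟨C, hC⟩ := exists_abs_le_of_isBounded hG hB_bdd
  refine (measureReal_mul_integral_sq_sub_le_of_integral_exp_mul_le (C := C)
    hG.continuous.aestronglyMeasurable ?_ hq.aestronglyMeasurable (.of_forall hq₀) (.of_forall hqK)
    (fun t _ => (measurable_supConv hw_meas hG.continuous).aestronglyMeasurable)
    (fun t ht => .of_forall (hsupK t ht)) hlim fun t ht =>
      integral_exp_mul_integral_exp_neg_le hB hB_conv hB_bdd hW hWw hw_meas hw hc hG ht).trans_eq ?_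
  · filter_upwards [ae_gibbsMeasure_mem hB] with x hx using hC x hx
  · rw [integral_div]
    ring

end BrascampLieb

section Localization

lemma convex_setOf_lt_infEDist_compl {E : Type*} [SeminormedAddCommGroup E] [NormedSpace ℝ E]
    {Ω : Set E} (hΩ : Convex ℝ Ω) (ρ : ℝ≥0∞) : Convex ℝ {x | ρ < Metric.infEDist x Ωᶜ} := by
  intro x hx y hy a b ha hb hab
  refine (lt_min hx hy).trans_le (Metric.le_infEDist.2 fun q hq => ?_)
  by_contra! hlt
  have hmem {p : E} (hp : edist (a • x + b • y) q < Metric.infEDist p Ωᶜ) :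
      p + (q - (a • x + b • y)) ∈ Ω := by
    by_contra hpΩ
    refine hp.not_ge ((Metric.infEDist_le_edist_of_mem hpΩ).trans_eq ?_)
    rw [edist_comm _ q, edist_comm p, edist_eq_enorm_sub, edist_eq_enorm_sub, add_sub_cancel_left]
  obtain ⟨hx', hy'⟩ := lt_min_iff.1 hlt
  refine hq ?_
  convert hΩ (hmem hx') (hmem hy') ha hb hab using 1
  obtain rfl : b = 1 - a := by linarith
  module

lemma exists_convex_exhaustion {E : Type*} [NormedAddCommGroup E] [NormedSpace ℝ E]
    [ProperSpace E] {Ω : Set E} (hΩ : IsOpen Ω) (hΩ_conv : Convex ℝ Ω) :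
    ∃ B : ℕ → Set E, Monotone B ∧ ⋃ m, B m = Ω ∧
      ∀ m, IsOpen (B m) ∧ Convex ℝ (B m) ∧ IsCompact (closure (B m)) ∧ closure (B m) ⊆ Ω := by
  let r : ℕ → ℝ := fun m => 1 / ((m : ℝ) + 1)
  have hr (m : ℕ) : 0 < r m := Nat.one_div_pos_of_nat
  let B : ℕ → Set E := fun m => Metric.ball 0 m ∩ (Metric.cthickening (r m) Ωᶜ)ᶜ
  refine ⟨B, fun m m' hm => ?_, ?_, fun m => ⟨?_, ?_, ?_, ?_⟩⟩
  · exact inter_subset_inter (Metric.ball_subset_ball (by exact_mod_cast hm))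
      (compl_subset_compl.2 (Metric.cthickening_mono (Nat.one_div_le_one_div hm) _))
  · refine (iUnion_subset fun m x hx => ?_).antisymm fun x hx => ?_
    · exact not_notMem.1 fun hxΩ => hx.2 (Metric.self_subset_cthickening _ hxΩ)
    · have hxr : ∀ᶠ m in atTop, x ∉ Metric.cthickening (r m) Ωᶜ :=
        tendsto_one_div_add_atTop_nhds_zero_nat.eventually
          (Metric.eventually_notMem_cthickening_of_infEDist_pos
            (by rwa [hΩ.isClosed_compl.closure_eq, notMem_compl_iff]))
      have hxm : ∀ᶠ m : ℕ in atTop, ‖x‖ < m :=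
        tendsto_natCast_atTop_atTop.eventually_gt_atTop ‖x‖
      obtain ⟨m, hm⟩ := (hxr.and hxm).exists
      exact mem_iUnion.2 ⟨m, mem_ball_zero_iff.2 hm.2, hm.1⟩
  · exact Metric.isOpen_ball.inter Metric.isClosed_cthickening.isOpen_compl
  · refine (convex_ball 0 _).inter ?_
    convert convex_setOf_lt_infEDist_compl hΩ_conv (ENNReal.ofReal (r m)) using 1
    ext x
    simp [Metric.cthickening]
  · exact (Metric.isBounded_ball.subset inter_subset_left).isCompact_closure
  · calc closure (B m) ⊆ closure (Metric.thickening (r m) Ωᶜ)ᶜ :=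
          closure_mono (inter_subset_right.trans
            (compl_subset_compl.2 (Metric.thickening_subset_cthickening _ _)))
      _ = (Metric.thickening (r m) Ωᶜ)ᶜ := Metric.isOpen_thickening.isClosed_compl.closure_eq
      _ ⊆ Ω := compl_subset_comm.1 (Metric.self_subset_thickening (hr m) _)

lemma lintegral_ofReal_sq_le_of_measureReal_mul_integral_sq_sub_le {α : Type*} [MeasurableSpace α]
    {ν : Measure α} [IsFiniteMeasure ν] {g q : α → ℝ} (hg : MemLp g 2 ν)
    (hq : AEStronglyMeasurable q ν) (hq₀ : ∀ᵐ x ∂ν, 0 ≤ q x)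
    (h : ν.real univ * (∫ x, g x ^ 2 ∂ν) - (∫ x, g x ∂ν) ^ 2 ≤ ν.real univ * ∫ x, q x ∂ν) :
    ∫⁻ x, ENNReal.ofReal (g x ^ 2) ∂ν ≤
      ENNReal.ofReal ((∫ x, g x ∂ν) ^ 2) / ν univ + ∫⁻ x, ENNReal.ofReal (q x) ∂ν := by
  rcases eq_zero_or_neZero ν with rfl | hν
  · simp
  have hM : 0 < ν.real univ := measureReal_univ_pos
  have hreal : ∫ x, g x ^ 2 ∂ν ≤ (∫ x, g x ∂ν) ^ 2 / ν.real univ + ∫ x, q x ∂ν := by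
    rw [← sub_le_iff_le_add, le_div_iff₀ hM]
    linarith
  calc ∫⁻ x, ENNReal.ofReal (g x ^ 2) ∂ν = ENNReal.ofReal (∫ x, g x ^ 2 ∂ν) :=
        (ofReal_integral_eq_lintegral_ofReal hg.integrable_sq
          (.of_forall fun _ => sq_nonneg _)).symm
    _ ≤ ENNReal.ofReal ((∫ x, g x ∂ν) ^ 2 / ν.real univ) + ENNReal.ofReal (∫ x, q x ∂ν) :=
        (ENNReal.ofReal_le_ofReal hreal).trans ENNReal.ofReal_add_le
    _ ≤ ENNReal.ofReal ((∫ x, g x ∂ν) ^ 2) / ν univ + ∫⁻ x, ENNReal.ofReal (q x) ∂ν := by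
        gcongr
        · rw [ENNReal.ofReal_div_of_pos hM, ofReal_measureReal]
        · rw [integral_eq_lintegral_of_nonneg_ae hq₀ hq]
          exact ENNReal.ofReal_toReal_le

lemma exists_pos_forall_le_of_isCompact {ι X : Type*} [Finite ι] [TopologicalSpace X] {K : Set X}
    (hK : IsCompact K) {w : ι → X → ℝ} (hw : ∀ i, ContinuousOn (w i) K)
    (hw₀ : ∀ i, ∀ x ∈ K, 0 < w i x) : ∃ c > 0, ∀ i, ∀ x ∈ K, c ≤ w i x := by
  choose c hc hcw using fun i => hK.exists_forall_le' (hw i) (hw₀ i)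
  obtain ⟨c₀, hc₀⟩ := Finite.exists_ge fun i => (⟨c i, hc i⟩ : Ioi (0 : ℝ))
  exact ⟨c₀, c₀.2, fun i x hx => le_trans (hc₀ i) (hcw i x hx)⟩

variable {n : ℕ} {B Ω : Set (Fin n → ℝ)} {W : (Fin n → ℝ) → ℝ} {w : Fin n → (Fin n → ℝ) → ℝ}
  {g : (Fin n → ℝ) → ℝ}

lemma HessianGEDiagonalOn.mono (h : HessianGEDiagonalOn Ω W w) (hBΩ : B ⊆ Ω) :
    HessianGEDiagonalOn B W w :=
  fun z v hp hm => h z v (hBΩ hp) (hBΩ hm)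

lemma HessianGEDiagonalOn.congr {W' : (Fin n → ℝ) → ℝ} {w' : Fin n → (Fin n → ℝ) → ℝ}
    (h : HessianGEDiagonalOn B W w) (hB : Convex ℝ B) (hW : EqOn W W' B)
    (hw : ∀ i, EqOn (w i) (w' i) B) : HessianGEDiagonalOn B W' w' := by
  intro z v hp hm
  have hz : z ∈ B := by
    convert hB hp hm (by norm_num : (0 : ℝ) ≤ 1 / 2) (by norm_num : (0 : ℝ) ≤ 1 / 2)
      (by norm_num) using 1
    module
  simpa only [← hW hz, ← hW hp, ← hW hm, ← hw _ hz] using h z v hp hm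

variable {L : ℝ≥0} {c : ℝ}

lemma lintegral_sq_gibbsMeasure_le_of_lipschitzWith {G : (Fin n → ℝ) → ℝ} (hB : MeasurableSet B)
    (hB_conv : Convex ℝ B) (hB_bdd : Bornology.IsBounded B) [IsFiniteMeasure (gibbsMeasure B W)]
    (hW : Measurable W) (hWw : HessianGEDiagonalOn B W w) (hw_meas : ∀ i, Measurable (w i))
    (hw : ∀ i z, c ≤ w i z) (hc : 0 < c) (hG : LipschitzWith L G) :
    ∫⁻ x, ENNReal.ofReal (G x ^ 2) ∂gibbsMeasure B W ≤
      ENNReal.ofReal ((∫ x, G x ∂gibbsMeasure B W) ^ 2) / gibbsMeasure B W univ +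
        ∫⁻ x, ENNReal.ofReal (∑ i, partialD i G x ^ 2 / w i x) ∂gibbsMeasure B W := by
  have hDm (i : Fin n) : Measurable (partialD i G) := measurable_lineDeriv hG.continuous
  obtain ⟨C, hC⟩ := exists_abs_le_of_isBounded hG hB_bdd
  have hG₂ : MemLp G 2 (gibbsMeasure B W) := by
    refine .of_bound hG.continuous.aestronglyMeasurable C ?_
    filter_upwards [ae_gibbsMeasure_mem hB] with x hx using hC x hx
  refine lintegral_ofReal_sq_le_of_measureReal_mul_integral_sq_sub_le hG₂
    (Finset.measurable_sum _ fun i _ => by fun_prop).aestronglyMeasurable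
    (.of_forall fun x => Finset.sum_nonneg fun i _ => ?_)
    (brascampLieb_of_lipschitzWith hB hB_conv hB_bdd hW hWw hw_meas hw hc hG)
  exact div_nonneg (sq_nonneg _) (hc.le.trans (hw i x))

lemma brascampLieb_of_isCompact_closure (hB : IsOpen B) (hB_conv : Convex ℝ B)
    (hB_cpt : IsCompact (closure B)) (hW : ContinuousOn W (closure B))
    (hw : ∀ i, ContinuousOn (w i) (closure B)) (hw₀ : ∀ i, ∀ x ∈ closure B, 0 < w i x)
    (hWw : HessianGEDiagonalOn B W w) (hg : LocallyLipschitzOn (closure B) g) :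
    ∫⁻ x, ENNReal.ofReal (g x ^ 2) ∂gibbsMeasure B W ≤
      ENNReal.ofReal ((∫ x, g x ∂gibbsMeasure B W) ^ 2) / gibbsMeasure B W univ +
        ∫⁻ x, ENNReal.ofReal (∑ i, partialD i g x ^ 2 / w i x) ∂gibbsMeasure B W := by
  classical
  have hB_bdd : Bornology.IsBounded B := hB_cpt.isBounded.subset subset_closure
  obtain ⟨L, hL⟩ := hg.exists_lipschitzOnWith_of_compact hB_cpt
  obtain ⟨G, hG, hgG⟩ := (hL.mono subset_closure).extend_real
  obtain ⟨C, hC⟩ := hB_cpt.bddBelow_image hW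
  obtain ⟨c, hc, hcw⟩ := exists_pos_forall_le_of_isCompact hB_cpt hw hw₀
  let W' : (Fin n → ℝ) → ℝ := B.piecewise W 0
  let w' : Fin n → (Fin n → ℝ) → ℝ := fun i => B.piecewise (w i) fun _ => c
  have hW' : Measurable W' :=
    (hW.mono subset_closure).measurable_piecewise continuousOn_const hB.measurableSet
  have hw' (i : Fin n) : Measurable (w' i) :=
    ((hw i).mono subset_closure).measurable_piecewise continuousOn_const hB.measurableSet
  have hcw' (i : Fin n) (x : Fin n → ℝ) : c ≤ w' i x := by
    by_cases hx : x ∈ B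
    · simpa [w', hx] using hcw i x (subset_closure hx)
    · simp [w', hx]
  have hWW' : EqOn W W' B := (B.piecewise_eqOn W 0).symm
  have hww' (i : Fin n) : EqOn (w i) (w' i) B := (B.piecewise_eqOn _ _).symm
  rw [gibbsMeasure_congr hB.measurableSet hWW']
  have hfin : IsFiniteMeasure (gibbsMeasure B W') :=
    isFiniteMeasure_gibbsMeasure hB.measurableSet hB_bdd (C := C) fun x hx =>
      (hC (mem_image_of_mem W (subset_closure hx))).trans_eq (hWW' hx)
  have hae : ∀ᵐ x ∂gibbsMeasure B W', x ∈ B := ae_gibbsMeasure_mem hB.measurableSet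
  have hD {x : Fin n → ℝ} (hx : x ∈ B) (i : Fin n) : partialD i g x = partialD i G x :=
    (hgG.eventuallyEq_of_mem (hB.mem_nhds hx)).lineDeriv_eq
  convert lintegral_sq_gibbsMeasure_le_of_lipschitzWith hB.measurableSet hB_conv hB_bdd hW'
    (hWw.congr hB_conv hWW' hww') hw' hcw' hc hG using 1
  · refine lintegral_congr_ae ?_
    filter_upwards [hae] with x hx
    rw [hgG hx]
  · congr 1
    · rw [integral_congr_ae (hae.mono fun x hx => hgG hx)]
    · refine lintegral_congr_ae ?_
      filter_upwards [hae] with x hx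
      simp only [hD hx, hww' _ hx]

lemma lintegral_ofReal_sq_le_of_aecover {α : Type*} [MeasurableSpace α] {ν : Measure α}
    {B : ℕ → Set α} (hB : AECover ν atTop B) {g : α → ℝ} (hg : Integrable g ν)
    (hg_mean : ∫ x, g x ∂ν = 0) {R : ℝ≥0∞}
    (h : ∀ m, ∫⁻ x in B m, ENNReal.ofReal (g x ^ 2) ∂ν ≤
      ENNReal.ofReal ((∫ x in B m, g x ∂ν) ^ 2) / ν (B m) + R) :
    ∫⁻ x, ENNReal.ofReal (g x ^ 2) ∂ν ≤ R := by
  rcases eq_zero_or_neZero ν with rfl | hν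
  · simp
  have hsq : Tendsto (fun m => ∫⁻ x in B m, ENNReal.ofReal (g x ^ 2) ∂ν) atTop
      (𝓝 (∫⁻ x, ENNReal.ofReal (g x ^ 2) ∂ν)) :=
    hB.lintegral_tendsto_of_countably_generated (hg.aemeasurable.pow_const 2).ennreal_ofReal
  have hmass : Tendsto (fun m => ν (B m)) atTop (𝓝 (ν univ)) := by
    simpa using hB.lintegral_tendsto_of_countably_generated (f := fun _ => 1) aemeasurable_const
  have hmean : Tendsto (fun m => ENNReal.ofReal ((∫ x in B m, g x ∂ν) ^ 2)) atTop (𝓝 0) := by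
    have := hB.integral_tendsto_of_countably_generated hg
    rw [hg_mean] at this
    simpa using ENNReal.tendsto_ofReal (this.pow 2)
  have hquot : Tendsto (fun m => ENNReal.ofReal ((∫ x in B m, g x ∂ν) ^ 2) / ν (B m)) atTop
      (𝓝 0) := by
    simpa using ENNReal.Tendsto.div hmean (.inr (NeZero.ne _)) hmass (.inr ENNReal.zero_ne_top)
  simpa using le_of_tendsto_of_tendsto' hsq (hquot.add_const R) h

lemma brascampLieb (hΩ : IsOpen Ω) (hΩ_conv : Convex ℝ Ω) (hW : ContinuousOn W Ω)
    (hw : ∀ i, ContinuousOn (w i) Ω) (hw₀ : ∀ i, ∀ x ∈ Ω, 0 < w i x)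
    (hWw : HessianGEDiagonalOn Ω W w) (hg : LocallyLipschitzOn Ω g)
    (hg_int : Integrable g (gibbsMeasure Ω W)) (hg_mean : ∫ x, g x ∂gibbsMeasure Ω W = 0) :
    ∫⁻ x, ENNReal.ofReal (g x ^ 2) ∂gibbsMeasure Ω W ≤
      ∫⁻ x, ENNReal.ofReal (∑ i, partialD i g x ^ 2 / w i x) ∂gibbsMeasure Ω W := by
  obtain ⟨B, hB_mono, hB_iUnion, hB⟩ := exists_convex_exhaustion hΩ hΩ_conv
  refine lintegral_ofReal_sq_le_of_aecover (B := B)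
    ⟨?_, fun m => (hB m).1.measurableSet⟩ hg_int hg_mean fun m => ?_
  · filter_upwards [ae_gibbsMeasure_mem hΩ.measurableSet] with x hx
    obtain ⟨m, hm⟩ := mem_iUnion.1 (hB_iUnion.symm.subset hx)
    filter_upwards [eventually_ge_atTop m] with m' hm' using hB_mono hm' hm
  · obtain ⟨hBo, hB_conv, hB_cpt, hBΩ⟩ := hB m
    rw [← Measure.restrict_apply_univ,
      restrict_gibbsMeasure hBo.measurableSet (subset_closure.trans hBΩ)]
    refine (brascampLieb_of_isCompact_closure hBo hB_conv hB_cpt (hW.mono hBΩ)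
      (fun i => (hw i).mono hBΩ) (fun i x hx => hw₀ i x (hBΩ hx))
      (hWw.mono (subset_closure.trans hBΩ)) (hg.mono hBΩ)).trans ?_
    rw [← restrict_gibbsMeasure hBo.measurableSet (subset_closure.trans hBΩ)]
    gcongr
    exact Measure.restrict_le_self

end Localization

section LocallyLipschitz

lemma locallyLipschitzOn_comp {X Y Z : Type*} [PseudoEMetricSpace X] [PseudoEMetricSpace Y]
    [PseudoEMetricSpace Z] {f : Y → Z} {h : X → Y} {s : Set X} {t : Set Y}
    (hf : LocallyLipschitzOn t f) (hh : LocallyLipschitzOn s h) (hst : MapsTo h s t) :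
    LocallyLipschitzOn s (f ∘ h) := by
  intro x hx
  obtain ⟨K, u, hu, hK⟩ := hf (hst hx)
  obtain ⟨K', u', hu', hK'⟩ := hh hx
  have hpre : h ⁻¹' u ∈ 𝓝[s] x := (hh.continuousOn x hx).tendsto_nhdsWithin hst hu
  exact ⟨K * K', u' ∩ h ⁻¹' u, inter_mem hu' hpre, hK.comp (hK'.mono inter_subset_left)
    inter_subset_right⟩

lemma ae_differentiableAt_of_locallyLipschitzOn {E F : Type*} [NormedAddCommGroup E]
    [NormedSpace ℝ E] [FiniteDimensional ℝ E] [MeasurableSpace E] [BorelSpace E]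
    [NormedAddCommGroup F] [NormedSpace ℝ F] [FiniteDimensional ℝ F] {μ : Measure E}
    [μ.IsAddHaarMeasure] {f : E → F} {Ω : Set E} (hΩ : IsOpen Ω) (hf : LocallyLipschitzOn Ω f) :
    ∀ᵐ x ∂μ.restrict Ω, DifferentiableAt ℝ f x := by
  rw [ae_restrict_iff' hΩ.measurableSet, ae_iff]
  refine measure_null_of_locally_null _ fun x hx => ?_
  obtain ⟨hxΩ, -⟩ := Classical.not_imp.1 hx
  obtain ⟨K, u, hu, hK⟩ := hf hxΩ
  rw [hΩ.nhdsWithin_eq hxΩ] at hu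
  have hdiff : ∀ᵐ y ∂μ, y ∈ interior u → DifferentiableAt ℝ f y := by
    filter_upwards [(hK.mono interior_subset).ae_differentiableWithinAt_of_mem (μ := μ)]
      with y hy hyu
    exact (hy hyu).differentiableAt (isOpen_interior.mem_nhds hyu)
  refine ⟨_, inter_mem (mem_nhdsWithin_of_mem_nhds (interior_mem_nhds.2 hu)) self_mem_nhdsWithin,
    measure_mono_null ?_ (ae_iff.1 hdiff)⟩
  rintro y ⟨hyu, hy⟩ hy'
  exact hy fun _ => hy' hyu

end LocallyLipschitz

section CoordPow

variable {n : ℕ}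

lemma isOpen_posOrthant : IsOpen (posOrthant n) := by
  simpa only [posOrthant, ofPred_forall] using
    isOpen_iInter_of_finite fun i => isOpen_lt continuous_const (continuous_apply i)

lemma convex_posOrthant : Convex ℝ (posOrthant n) :=
  fun _ hx _ hy _ _ ha hb hab i => convex_Ioi (0 : ℝ) (hx i) (hy i) ha hb hab

/-- The substitution `x i = y i ^ k i`. -/
noncomputable def coordPow (k : Fin n → ℝ) (y : Fin n → ℝ) : Fin n → ℝ :=
  fun i => y i ^ k i

/-- The potential of the pullback of the measure with density `exp (-φ)` on the orthant under
`coordPow k`: the sum is the logarithm of the absolute value of the Jacobian determinant. -/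
noncomputable def powPotential (k : Fin n → ℝ) (φ : (Fin n → ℝ) → ℝ) (y : Fin n → ℝ) : ℝ :=
  φ (coordPow k y) - ∑ i, Real.log (k i * y i ^ (k i - 1))

variable {k : Fin n → ℝ} {φ : (Fin n → ℝ) → ℝ} {y : Fin n → ℝ}

lemma orthantMeasure_eq_gibbsMeasure : orthantMeasure φ = gibbsMeasure (posOrthant n) φ := rfl

lemma measurable_coordPow : Measurable (coordPow k) := by
  unfold coordPow
  fun_prop

lemma mapsTo_coordPow : MapsTo (coordPow k) (posOrthant n) (posOrthant n) :=
  fun _ hy i => Real.rpow_pos_of_pos (hy i) _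

lemma coordPow_inv_coordPow (hk : ∀ i, k i ≠ 0) (hy : y ∈ posOrthant n) :
    coordPow k⁻¹ (coordPow k y) = y :=
  funext fun i => Real.rpow_rpow_inv (hy i).le (hk i)

lemma coordPow_coordPow_inv (hk : ∀ i, k i ≠ 0) (hy : y ∈ posOrthant n) :
    coordPow k (coordPow k⁻¹ y) = y :=
  funext fun i => Real.rpow_inv_rpow (hy i).le (hk i)

lemma bijOn_coordPow (hk : ∀ i, k i ≠ 0) :
    BijOn (coordPow k) (posOrthant n) (posOrthant n) :=
  InvOn.bijOn ⟨fun _ hy => coordPow_inv_coordPow hk hy, fun _ hx => coordPow_coordPow_inv hk hx⟩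
    mapsTo_coordPow mapsTo_coordPow

lemma contDiffOn_coordPow : ContDiffOn ℝ 1 (coordPow k) (posOrthant n) :=
  contDiffOn_pi.2 fun i _ hy =>
    ((contDiff_apply ℝ ℝ i).contDiffAt.rpow_const_of_ne (hy i).ne').contDiffWithinAt

lemma locallyLipschitzOn_coordPow : LocallyLipschitzOn (posOrthant n) (coordPow k) :=
  contDiffOn_coordPow.locallyLipschitzOn convex_posOrthant

lemma hasFDerivAt_coordPow (hy : y ∈ posOrthant n) :
    HasFDerivAt (coordPow k) (ContinuousLinearMap.pi fun i =>
      (ContinuousLinearMap.toSpanSingleton ℝ (k i * y i ^ (k i - 1))).comp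
        (ContinuousLinearMap.proj i)) y := by
  rw [hasFDerivAt_pi]
  intro i
  have hcomp := (Real.hasDerivAt_rpow_const (p := k i) (.inl (hy i).ne')).hasFDerivAt.comp y
    (ContinuousLinearMap.proj (R := ℝ) (φ := fun _ : Fin n => ℝ) i).hasFDerivAt
  exact hcomp

lemma partialD_comp_coordPow {f : (Fin n → ℝ) → ℝ} (hy : y ∈ posOrthant n)
    (hf : DifferentiableAt ℝ f (coordPow k y)) (i : Fin n) :
    partialD i (f ∘ coordPow k) y = k i * y i ^ (k i - 1) * partialD i f (coordPow k y) := by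
  have hcomp := hf.hasFDerivAt.comp y (hasFDerivAt_coordPow hy)
  rw [partialD, partialD, hcomp.differentiableAt.lineDeriv_eq_fderiv, hcomp.fderiv,
    hf.lineDeriv_eq_fderiv, ← smul_eq_mul, ← map_smul, ContinuousLinearMap.comp_apply]
  congr 1
  ext j
  rcases eq_or_ne j i with rfl | hj
  · simp
  · simp [hj]

lemma jacobian_ne_zero (hk : ∀ i, k i ≠ 0) (hy : y ∈ posOrthant n) (i : Fin n) :
    k i * y i ^ (k i - 1) ≠ 0 :=
  mul_ne_zero (hk i) (Real.rpow_pos_of_pos (hy i) _).ne'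

lemma continuousOn_powPotential (hk : ∀ i, k i ≠ 0)
    (hφ : ContinuousOn (φ ∘ coordPow k) (posOrthant n)) :
    ContinuousOn (powPotential k φ) (posOrthant n) := by
  refine hφ.sub (continuousOn_finsetSum _ fun i _ => ContinuousOn.log ?_ fun y hy =>
    jacobian_ne_zero hk hy i)
  exact continuousOn_const.mul
    ((continuous_apply i).continuousOn.rpow_const fun y hy => .inl (hy i).ne')

lemma ofReal_exp_neg_powPotential (hk : ∀ i, k i ≠ 0) (hy : y ∈ posOrthant n) :
    ENNReal.ofReal (Real.exp (-powPotential k φ y)) =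
      ENNReal.ofReal |∏ i, k i * y i ^ (k i - 1)| *
        ENNReal.ofReal (Real.exp (-φ (coordPow k y))) := by
  rw [← ENNReal.ofReal_mul (abs_nonneg _), powPotential, neg_sub', sub_neg_eq_add, Real.exp_add,
    Real.exp_sum, Finset.abs_prod, mul_comm]
  congr 2
  exact Finset.prod_congr rfl fun i _ => Real.exp_log_eq_abs (jacobian_ne_zero hk hy i)

lemma continuousOn_of_comp_coordPow (hk : ∀ i, k i ≠ 0)
    (hφ : ContinuousOn (φ ∘ coordPow k) (posOrthant n)) : ContinuousOn φ (posOrthant n) :=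
  (hφ.comp contDiffOn_coordPow.continuousOn mapsTo_coordPow).congr fun _ hx =>
    (congrArg φ (coordPow_coordPow_inv hk hx)).symm

lemma lintegral_comp_coordPow (hk : ∀ i, k i ≠ 0)
    (hφ : ContinuousOn (φ ∘ coordPow k) (posOrthant n)) (F : (Fin n → ℝ) → ℝ≥0∞) :
    ∫⁻ y, F (coordPow k y) ∂gibbsMeasure (posOrthant n) (powPotential k φ) =
      ∫⁻ x, F x ∂gibbsMeasure (posOrthant n) φ := by
  have hO : MeasurableSet (posOrthant n) := isOpen_posOrthant.measurableSet
  rw [lintegral_gibbsMeasure hO (continuousOn_powPotential hk hφ),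
    lintegral_gibbsMeasure hO (continuousOn_of_comp_coordPow hk hφ)]
  nth_rw 2 [← (bijOn_coordPow hk).image_eq]
  rw [lintegral_image_eq_lintegral_abs_det_fderiv_mul volume hO
    (fun y hy => (hasFDerivAt_coordPow hy).hasFDerivWithinAt) (bijOn_coordPow hk).injOn]
  refine setLIntegral_congr_fun hO fun y hy => ?_
  simp only [ContinuousLinearMap.det_pi, ContinuousLinearMap.det_toSpanSingleton]
  rw [ofReal_exp_neg_powPotential hk hy, mul_assoc]

lemma measurePreserving_coordPow (hk : ∀ i, k i ≠ 0)
    (hφ : ContinuousOn (φ ∘ coordPow k) (posOrthant n)) :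
    MeasurePreserving (coordPow k) (gibbsMeasure (posOrthant n) (powPotential k φ))
      (gibbsMeasure (posOrthant n) φ) := by
  refine ⟨measurable_coordPow, Measure.ext_of_lintegral _ fun F hF => ?_⟩
  rw [lintegral_map hF measurable_coordPow, lintegral_comp_coordPow hk hφ]

lemma log_add_add_log_sub_add_sq_le {z v : ℝ} (hp : 0 < z + v) (hm : 0 < z - v) :
    Real.log (z + v) + Real.log (z - v) + (v / z) ^ 2 ≤ 2 * Real.log z := by
  have hz : 0 < z := by linarith
  have hlog := Real.log_le_sub_one_of_pos (x := (z + v) * (z - v) / z ^ 2) (by positivity)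
  rw [Real.log_div (by positivity) (by positivity), Real.log_mul hp.ne' hm.ne', Real.log_pow,
    show (z + v) * (z - v) / z ^ 2 - 1 = -(v / z) ^ 2 by field_simp; ring] at hlog
  push_cast at hlog
  linarith

lemma log_jacobian (hk : ∀ i, k i ≠ 0) (hy : y ∈ posOrthant n) (i : Fin n) :
    Real.log (k i * y i ^ (k i - 1)) = Real.log (k i) + (k i - 1) * Real.log (y i) := by
  rw [Real.log_mul (hk i) (Real.rpow_pos_of_pos (hy i) _).ne', Real.log_rpow (hy i)]

lemma hessianGEDiagonalOn_powPotential (hk : ∀ i, 1 ≤ k i)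
    (hφ : ConvexOn ℝ (posOrthant n) (φ ∘ coordPow k)) :
    HessianGEDiagonalOn (posOrthant n) (powPotential k φ) fun i z => (k i - 1) / z i ^ 2 := by
  intro z v hp hm
  have hk₀ (i : Fin n) : k i ≠ 0 := (one_pos.trans_le (hk i)).ne'
  have hmid : z = (1 / 2 : ℝ) • (z + v) + (1 / 2 : ℝ) • (z - v) := by module
  have hhalf : (0 : ℝ) ≤ 1 / 2 := by norm_num
  have hz : z ∈ posOrthant n := by
    rw [hmid]
    exact convex_posOrthant hp hm hhalf hhalf (by norm_num)
  have hconv := hφ.2 hp hm hhalf hhalf (by norm_num)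
  rw [← hmid, smul_eq_mul, smul_eq_mul] at hconv
  have hjac : ∑ i, Real.log (k i * (z + v) i ^ (k i - 1)) +
      ∑ i, Real.log (k i * (z - v) i ^ (k i - 1)) + ∑ i, (k i - 1) / z i ^ 2 * v i ^ 2 ≤
        2 * ∑ i, Real.log (k i * z i ^ (k i - 1)) := by
    rw [← Finset.sum_add_distrib, ← Finset.sum_add_distrib, Finset.mul_sum]
    gcongr with i
    have hlog := mul_le_mul_of_nonneg_left (log_add_add_log_sub_add_sq_le (hp i) (hm i))
      (sub_nonneg.2 (hk i))
    rw [log_jacobian hk₀ hp, log_jacobian hk₀ hm, log_jacobian hk₀ hz, div_mul_eq_mul_div,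
      mul_div_assoc, ← div_pow]
    simp only [Pi.add_apply, Pi.sub_apply]
    linarith
  simp only [powPotential, Function.comp_apply] at hconv ⊢
  linarith

lemma sum_sq_partialD_comp_coordPow {f : (Fin n → ℝ) → ℝ} (hy : y ∈ posOrthant n)
    (hf : DifferentiableAt ℝ f (coordPow k y)) :
    ∑ i, partialD i (f ∘ coordPow k) y ^ 2 / ((k i - 1) / y i ^ 2) =
      ∑ i, k i ^ 2 / (k i - 1) * coordPow k y i ^ 2 * |partialD i f (coordPow k y)| ^ 2 := by
  refine Finset.sum_congr rfl fun i _ => ?_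
  have hpow : coordPow k y i = y i * y i ^ (k i - 1) := by
    rw [coordPow, Real.rpow_sub_one (hy i).ne', mul_div_cancel₀ _ (hy i).ne']
  rw [partialD_comp_coordPow hy hf, hpow, sq_abs, div_div_eq_mul_div]
  ring

end CoordPow

theorem theorem6p1_general {n : ℕ} {k : Fin n → ℝ} (hk : ∀ i, 1 < k i) {φ : (Fin n → ℝ) → ℝ}
    (hconv : ConvexOn ℝ (posOrthant n) (fun x => φ (fun i => x i ^ k i)))
    {f : (Fin n → ℝ) → ℝ} (hlip : LocallyLipschitzOn (posOrthant n) f)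
    (hint : Integrable f (orthantMeasure φ))
    (hmean : ∫ x, f x ∂(orthantMeasure φ) = 0) :
    ∫⁻ x, ENNReal.ofReal (f x ^ 2) ∂(orthantMeasure φ) ≤
      ∫⁻ x, ENNReal.ofReal
        (∑ i, k i ^ 2 / (k i - 1) * x i ^ 2 * |partialD i f x| ^ 2) ∂(orthantMeasure φ) := by
  rw [orthantMeasure_eq_gibbsMeasure] at hint hmean ⊢
  have hk₀ (i : Fin n) : k i ≠ 0 := (one_pos.trans (hk i)).ne'
  have hcont : ContinuousOn (φ ∘ coordPow k) (posOrthant n) := hconv.continuousOn isOpen_posOrthant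
  have hpres := measurePreserving_coordPow hk₀ hcont
  have hdiff : ∀ᵐ y ∂gibbsMeasure (posOrthant n) (powPotential k φ),
      DifferentiableAt ℝ f (coordPow k y) :=
    hpres.quasiMeasurePreserving.ae (gibbsMeasure_absolutelyContinuous.ae_le
      (ae_differentiableAt_of_locallyLipschitzOn isOpen_posOrthant hlip))
  have hmean' : ∫ y, (f ∘ coordPow k) y ∂gibbsMeasure (posOrthant n) (powPotential k φ) = 0 := by
    rw [← hmean, ← hpres.map_eq]
    exact (integral_map measurable_coordPow.aemeasurable (hpres.map_eq ▸ hint.1)).symm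
  have hBL := brascampLieb (w := fun i z => (k i - 1) / z i ^ 2) isOpen_posOrthant convex_posOrthant
    (continuousOn_powPotential hk₀ hcont)
    (fun i => continuousOn_const.div (by fun_prop) fun z hz => pow_ne_zero 2 (hz i).ne')
    (fun i z hz => div_pos (sub_pos.2 (hk i)) (pow_pos (hz i) 2))
    (hessianGEDiagonalOn_powPotential (fun i => (hk i).le) hconv)
    (locallyLipschitzOn_comp hlip locallyLipschitzOn_coordPow mapsTo_coordPow)
    (hpres.integrable_comp_of_integrable hint) hmean'
  rw [← lintegral_comp_coordPow hk₀ hcont, ← lintegral_comp_coordPow hk₀ hcont]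
  refine hBL.trans_eq (lintegral_congr_ae ?_)
  filter_upwards [hdiff, ae_gibbsMeasure_mem isOpen_posOrthant.measurableSet] with y hf hy
  rw [sum_sq_partialD_comp_coordPow hy hf]

/-- `φ` and `f` are functions on the open orthant: every hypothesis and the conclusion only involve
their values there. The measure may have infinite mass. Both sides of the inequality are integrals
of nonnegative functions with values in `[0, ∞]`, so that the finiteness of the right-hand side
forces `f ∈ L²(μ)`. -/
theorem theorem6p1 (n : ℕ) (hn : 1 ≤ n) (k : Fin n → ℝ) (hk : ∀ i, 1 < k i)
    (φ : (Fin n → ℝ) → ℝ) (hφ : ContDiffOn ℝ ∞ φ (posOrthant n))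
    (hconv : ConvexOn ℝ (posOrthant n) (fun x => φ (fun i => x i ^ k i)))
    (f : (Fin n → ℝ) → ℝ) (hlip : LocallyLipschitzOn (posOrthant n) f)
    (hint : Integrable f (orthantMeasure φ))
    (hmean : ∫ x, f x ∂(orthantMeasure φ) = 0) :
    ∫⁻ x, ENNReal.ofReal (f x ^ 2) ∂(orthantMeasure φ) ≤
      ∫⁻ x, ENNReal.ofReal
        (∑ i, k i ^ 2 / (k i - 1) * x i ^ 2 * |partialD i f x| ^ 2) ∂(orthantMeasure φ) :=
  theorem6p1_general hk hconv hlip hint hmean
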